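/- Let $d\ge 1$ and let $S\subseteq\mathbb N^d$ be an affine semigroup, i.e. a finitely generated submonoid, with (unique) minimal system of generators $\{a_1,\dots,a_n\}$; the number $n=e(S)$ is its embedding dimension. Let $\mathrm{cone}(S)=\{\sum_i\lambda_i a_i : \lambda_i\in\mathbb Q_{\ge 0}\}$ and $\mathcal H(S)=(\mathrm{cone}(S)\setminus S)\cap\mathbb N^d$. The set of pseudo-Frobenius elements of $S$ is $$\mathrm{PF}(S)=\{f\in\mathcal H(S) : f+s\in S\ \text{for all}\ s\in S\setminus\{0\}\},$$ and its cardinality is called the Betti-type of $S$. For $E\subseteq S$, the Apéry set is $\mathrm{Ap}(S,E)=\{b\in S : b-e\notin S\ \text{for all}\ e\in E\}$. Given a field $k$, regard the semigroup ring $k[S]$ as a module over $R=k[x_1,\dots,x_n]$ via $x_i\mapsto \mathbf t^{a_i}$; $S$ is called an MPD-semigroup (of maximal projective dimension) if $\mathrm{pdim}_R\,k[S]=n-1$. Let $k$ be any field. For an odd integer $a\ge 3$ and an integer $p\ge 1$ put $$S_{a,p}=\langle (a,0),\,(0,a^p),\,(a+2,2),\,(2,2+a^p)\rangle\subseteq\mathbb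 N^2,$$ $$\Delta=\{(a^p(a+2)-(\ell+2)a-2,\ a^p(\ell+2)-2) : \ell\in\mathbb Z,\ 0\le \ell<a^p-1\}.$$ Then: 1. $\mathrm{Ap}(S_{a,p},\{(a,0),(0,a^p)\})=\{\alpha(a+2,2)+\alpha'(2,2+a^p) : \alpha,\alpha'\in\mathbb N,\ \alpha+\alpha'<a^p\}$. 2. $S_{a,p}$ is an MPD-semigroup. 3. $\Delta$ is a set of exactly $a^p-1$ points of $\mathbb N^2$, and $\Delta\subseteq\mathrm{PF}(S_{a,p})$. 4. The Betti-type of $S_{a,p}$ is at least $a^p-1$, while its embedding dimension is $4$. In particular, the Betti-type is not bounded in terms of the embedding dimension: for every $N\in\mathbb N$ there are an odd $a\ge 3$ and a $p\ge 1$ such that the MPD-semigroup $S_{a,p}$ has embedding dimension $4$ and Betti-type at least $N$. -/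

import Mathlib

open CategoryTheory

namespace AffineSemigroup

variable {d : ℕ}

/-- `A` is a minimal system of generators of `S`: it generates `S` and no proper subset does. -/
def IsMinimalGeneratingSet (S : AddSubmonoid (Fin d → ℕ)) (A : Set (Fin d → ℕ)) : Prop :=
  Minimal (fun B : Set (Fin d → ℕ) => AddSubmonoid.closure B = S) A

/-- The minimal system of generators (Hilbert basis) of `S`: the nonzero elements of `S` that are
not a sum of two nonzero elements of `S`. That this is the unique minimal generating set is
`isMinimalGeneratingSet_iff` below. -/
def minimalGenerators (S : AddSubmonoid (Fin d → ℕ)) : Set (Fin d → ℕ) :=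
  {x | x ∈ S ∧ x ≠ 0 ∧ ∀ y ∈ S, ∀ z ∈ S, y + z = x → y = 0 ∨ z = 0}

/-- The embedding dimension `e(S)`. -/
noncomputable def embeddingDim (S : AddSubmonoid (Fin d → ℕ)) : ℕ∞ :=
  (minimalGenerators S).encard

/-- `cone(S)`: the nonnegative rational combinations of elements of `S`. -/
def cone (S : AddSubmonoid (Fin d → ℕ)) : Submodule ℚ≥0 (Fin d → ℚ) :=
  Submodule.span ℚ≥0 ((fun (x : Fin d → ℕ) (i : Fin d) => (x i : ℚ)) '' (S : Set (Fin d → ℕ)))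

/-- `H(S) = (cone(S) \ S) ∩ ℕ^d`. -/
def gaps (S : AddSubmonoid (Fin d → ℕ)) : Set (Fin d → ℕ) :=
  {x | (fun i => (x i : ℚ)) ∈ cone S ∧ x ∉ S}

/-- The set `PF(S)` of pseudo-Frobenius elements. -/
def pseudoFrobenius (S : AddSubmonoid (Fin d → ℕ)) : Set (Fin d → ℕ) :=
  {f | f ∈ gaps S ∧ ∀ s ∈ S, s ≠ 0 → f + s ∈ S}

/-- The Betti-type of `S`: the cardinality of `PF(S)`. -/
noncomputable def bettiType (S : AddSubmonoid (Fin d → ℕ)) : ℕ∞ :=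
  (pseudoFrobenius S).encard

/-- The Apéry set `{b ∈ S | b - e ∉ S for all e ∈ E}`; the difference is taken in `ℤ^d`, so
`b - e ∈ S` means that `b = s + e` for some `s ∈ S`. -/
def apery (S : AddSubmonoid (Fin d → ℕ)) (E : Set (Fin d → ℕ)) : Set (Fin d → ℕ) :=
  {b | b ∈ S ∧ ∀ e ∈ E, ¬ ∃ s ∈ S, s + e = b}

/-- The map `π : k[x_1, …, x_n] → k[S]`, `x_i ↦ t^{a_i}`, attached to elements `a_1, …, a_n`
of `S`. -/
noncomputable def presentation (k : Type*) [Field k] (S : AddSubmonoid (Fin d → ℕ)) {n : ℕ}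
    (g : Fin n → S) : MvPolynomial (Fin n) k →ₐ[k] AddMonoidAlgebra k S :=
  MvPolynomial.aeval fun i => AddMonoidAlgebra.single (g i) (1 : k)

/-- The semigroup ring `k[S]` as a module over `R = k[x_1, …, x_n]` through `π`. -/
noncomputable def semigroupRingModule (k : Type*) [Field k] (S : AddSubmonoid (Fin d → ℕ)) {n : ℕ}
    (g : Fin n → S) : ModuleCat (MvPolynomial (Fin n) k) :=
  (ModuleCat.restrictScalars (presentation k S g).toRingHom).obj
    (ModuleCat.of (AddMonoidAlgebra k S) (AddMonoidAlgebra k S))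

/-- `S` is an MPD-semigroup (over the field `k`): `S` is minimally generated by finitely many
elements `a_1, …, a_n`, and `pdim_R k[S] = n - 1` for `R = k[x_1, …, x_n]`. -/
def IsMPD (k : Type*) [Field k] (S : AddSubmonoid (Fin d → ℕ)) : Prop :=
  ∃ (n : ℕ) (g : Fin n → S), Function.Injective g ∧
    IsMinimalGeneratingSet S (Set.range fun i => (g i : Fin d → ℕ)) ∧
    projectiveDimension (semigroupRingModule k S g) + 1 = n

theorem minimalGenerators_subset {S : AddSubmonoid (Fin d → ℕ)} {A : Set (Fin d → ℕ)}
    (hA : AddSubmonoid.closure A = S) : minimalGenerators S ⊆ A := by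
  intro x hx
  obtain ⟨hxS, hx0, hirr⟩ := hx
  have key : ∀ y ∈ AddSubmonoid.closure A, y ≠ 0 →
      ∃ u ∈ A, ∃ v ∈ AddSubmonoid.closure A, u ≠ 0 ∧ u + v = y := by
    intro y hy
    induction hy using AddSubmonoid.closure_induction with
    | mem y hy => exact fun h => ⟨y, hy, 0, zero_mem _, h, add_zero _⟩
    | zero => exact fun h => absurd rfl h
    | add y z hy hz ihy ihz =>
      intro h
      by_cases hy0 : y = 0
      · subst hy0
        simpa using ihz (by simpa using h)
      · obtain ⟨u, hu, v, hv, hu0, rfl⟩ := ihy hy0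
        exact ⟨u, hu, v + z, add_mem hv hz, hu0, by rw [add_assoc]⟩
  obtain ⟨u, hu, v, hv, hu0, huv⟩ := key x (hA ▸ hxS) hx0
  rcases hirr u (hA ▸ AddSubmonoid.subset_closure hu) v (hA ▸ hv) huv with h | h
  · exact absurd h hu0
  · rw [h, add_zero] at huv
    exact huv ▸ hu

theorem closure_minimalGenerators (S : AddSubmonoid (Fin d → ℕ)) :
    AddSubmonoid.closure (minimalGenerators S) = S := by
  apply le_antisymm
  · rw [AddSubmonoid.closure_le]
    exact fun x hx => hx.1
  · intro x
    induction hm : ∑ i, x i using Nat.strong_induction_on generalizing x with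
    | _ m ih =>
      intro hx
      by_cases h0 : x = 0
      · exact h0 ▸ zero_mem _
      by_cases hirr : ∀ y ∈ S, ∀ z ∈ S, y + z = x → y = 0 ∨ z = 0
      · exact AddSubmonoid.subset_closure ⟨hx, h0, hirr⟩
      · push Not at hirr
        obtain ⟨y, hy, z, hz, rfl, hy0, hz0⟩ := hirr
        have pos : ∀ w : Fin d → ℕ, w ≠ 0 → 0 < ∑ i, w i := by
          intro w hw
          obtain ⟨i, hi⟩ := Function.ne_iff.mp hw
          exact Finset.sum_pos' (fun _ _ => Nat.zero_le _)
            ⟨i, Finset.mem_univ i, Nat.pos_of_ne_zero hi⟩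
        have h1 := pos y hy0
        have h2 := pos z hz0
        simp only [Pi.add_apply, Finset.sum_add_distrib] at hm
        exact add_mem (ih (∑ i, y i) (by omega) rfl hy) (ih (∑ i, z i) (by omega) rfl hz)

theorem isMinimalGeneratingSet_iff (S : AddSubmonoid (Fin d → ℕ)) (A : Set (Fin d → ℕ)) :
    IsMinimalGeneratingSet S A ↔ A = minimalGenerators S := by
  constructor
  · intro h
    exact (h.2 (closure_minimalGenerators S) (minimalGenerators_subset h.1)).antisymm
      (minimalGenerators_subset h.1)
  · rintro rfl
    exact ⟨closure_minimalGenerators S, fun B hB _ => minimalGenerators_subset hB⟩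

/-- `S_{a,p} = ⟨(a,0), (0,a^p), (a+2,2), (2,2+a^p)⟩`. -/
def Sap (a p : ℕ) : AddSubmonoid (Fin 2 → ℕ) :=
  AddSubmonoid.closure {![a, 0], ![0, a ^ p], ![a + 2, 2], ![2, 2 + a ^ p]}

/-- `Δ = {(a^p (a+2) - (ℓ+2) a - 2, a^p (ℓ+2) - 2) | 0 ≤ ℓ < a^p - 1}`, with the coordinates
computed in `ℤ`. -/
def Delta (a p : ℕ) : Set (Fin 2 → ℕ) :=
  {x | ∃ l : ℕ, (l : ℤ) < (a : ℤ) ^ p - 1 ∧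
    (x 0 : ℤ) = (a : ℤ) ^ p * (a + 2) - (l + 2) * a - 2 ∧
    (x 1 : ℤ) = (a : ℤ) ^ p * (l + 2) - 2}

end AffineSemigroup

/-!
Adjoining a variable raises projective dimension by at most one. Since `k[S]` is free over `k[x_n]`
(a monomial basis splits into orbits of translation by `a_n`), adjoining the other variables gives
`pdim k[S] ≤ n - 1`, and the same holds for `k[ℕ^d]`. If `f ∈ PF(S)`, the class of `t^f` in
`k[ℕ^d] / k[S]` is killed by every variable, so `k` embeds in this quotient. By Hilbert's syzygy
theorem and `pdim k = n` the quotient has projective dimension `n`, whence `pdim k[S] ≥ n - 1`.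

The elements of `S_{a,p}` are the points `m (2, 2) + i (a, 0) + j (0, a ^ p)` with `m ≤ i + j`. As
`a` is odd, two such representations of a point differ by a multiple of
`(a ^ p, -2 a ^ (p - 1), -2)`, so `i + j - m` is largest when `m < a ^ p`. In this normal form the
Apéry set is given by `m = i + j`, while `Δ` is given by `m = a ^ p - 1` and `i + j = a ^ p - 2`:
these points lie just outside `S_{a,p}`, and adding a nonzero element of `S_{a,p}` brings them in.
-/

universe u

section PolynomialExtension

open TensorProduct Polynomial

section

variable (A M : Type*) [CommRing A] [AddCommGroup M] [Module A M] [Module A[X] M]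
  [IsScalarTower A A[X] M]

/-- The map `f ⊗ m ↦ X f ⊗ m - f ⊗ X m`, the first differential of the standard resolution of an
`A[X]`-module `M` by extended modules. -/
noncomputable def polynomialTensorDiff : A[X] ⊗[A] M →ₗ[A[X]] A[X] ⊗[A] M :=
  (X : A[X]) • LinearMap.id - (Algebra.lsmul A A M (X : A[X])).baseChange A[X]

/-- The action `f ⊗ m ↦ f m`, the augmentation of the standard resolution of an `A[X]`-module `M`
by extended modules. -/
noncomputable def polynomialTensorAction : A[X] ⊗[A] M →ₗ[A[X]] M :=
  LinearMap.liftBaseChange A[X] LinearMap.id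

variable {A M}

theorem polynomialTensorDiff_tmul (f : A[X]) (m : M) :
    polynomialTensorDiff A M (f ⊗ₜ m) = (X * f) ⊗ₜ m - f ⊗ₜ ((X : A[X]) • m) := by
  simp [polynomialTensorDiff, TensorProduct.smul_tmul']

theorem polynomialTensorAction_tmul (f : A[X]) (m : M) :
    polynomialTensorAction A M (f ⊗ₜ m) = f • m := by
  simp [polynomialTensorAction]

theorem polynomialTensorAction_surjective :
    Function.Surjective (polynomialTensorAction A M) :=
  fun m => ⟨1 ⊗ₜ m, by rw [polynomialTensorAction_tmul, one_smul]⟩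

theorem polynomialTensorAction_tensorDiff (z : A[X] ⊗[A] M) :
    polynomialTensorAction A M (polynomialTensorDiff A M z) = 0 := by
  induction z with
  | zero => rw [map_zero, map_zero]
  | tmul f m =>
    rw [polynomialTensorDiff_tmul, map_sub, polynomialTensorAction_tmul,
      polynomialTensorAction_tmul, smul_smul, mul_comm f, sub_self]
  | add x y hx hy => rw [map_add, map_add, hx, hy, add_zero]

theorem tmul_sub_one_tmul_smul_mem_range (f : A[X]) (m : M) :
    f ⊗ₜ m - 1 ⊗ₜ (f • m) ∈ LinearMap.range (polynomialTensorDiff A M) := by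
  induction f using Polynomial.induction_on' generalizing m with
  | add f g hf hg =>
    have h := add_mem (hf m) (hg m)
    rwa [sub_add_sub_comm, ← TensorProduct.add_tmul, ← TensorProduct.tmul_add, ← add_smul] at h
  | monomial n c =>
    induction n generalizing m with
    | zero =>
      rw [monomial_zero_left, ← mul_one (C c), C_mul', TensorProduct.smul_tmul, smul_assoc,
        one_smul, sub_self]
      exact zero_mem _
    | succ n ih =>
      have h := add_mem (LinearMap.mem_range_self (polynomialTensorDiff A M) (monomial n c ⊗ₜ m))
        (ih ((X : A[X]) • m))
      rwa [polynomialTensorDiff_tmul, sub_add_sub_cancel, smul_smul, mul_comm _ X,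
        X_mul_monomial] at h

theorem sub_one_tmul_action_mem_range (z : A[X] ⊗[A] M) :
    z - 1 ⊗ₜ polynomialTensorAction A M z ∈ LinearMap.range (polynomialTensorDiff A M) := by
  induction z with
  | zero => simp
  | tmul f m =>
    rw [polynomialTensorAction_tmul]
    exact tmul_sub_one_tmul_smul_mem_range f m
  | add x y hx hy =>
    rw [map_add, TensorProduct.tmul_add, add_sub_add_comm]
    exact add_mem hx hy

theorem polynomialTensor_exact :
    Function.Exact (polynomialTensorDiff A M) (polynomialTensorAction A M) := by
  intro z
  constructor
  · intro hz
    have h := sub_one_tmul_action_mem_range z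
    rwa [hz, TensorProduct.tmul_zero, sub_zero] at h
  · rintro ⟨z, rfl⟩
    exact polynomialTensorAction_tensorDiff z

theorem polynomialTensorDiff_injective : Function.Injective (polynomialTensorDiff A M) := by
  classical
  let coeffs := TensorProduct.equivFinsuppOfBasisLeft (N := M) (Polynomial.basisMonomials A)
  have coeffs_diff (z : A[X] ⊗[A] M) (n : ℕ) : coeffs (polynomialTensorDiff A M z) (n + 1) =
      coeffs z n - (X : A[X]) • coeffs z (n + 1) := by
    induction z with
    | zero => simp
    | tmul f m =>
      rw [polynomialTensorDiff_tmul, map_sub, Finsupp.sub_apply]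
      simp only [coeffs, TensorProduct.equivFinsuppOfBasisLeft_apply_tmul_apply]
      change (X * f).coeff (n + 1) • m - f.coeff (n + 1) • (X : A[X]) • m =
        f.coeff n • m - (X : A[X]) • f.coeff (n + 1) • m
      rw [coeff_X_mul, smul_comm]
    | add x y hx hy =>
      simp only [map_add, Finsupp.add_apply, hx, hy, smul_add]
      abel
  rw [injective_iff_map_eq_zero]
  intro z hz
  have coeff_eq_smul (n : ℕ) : coeffs z n = (X : A[X]) • coeffs z (n + 1) := by
    rw [← sub_eq_zero, ← coeffs_diff, hz, map_zero, Finsupp.zero_apply]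
  have coeff_eq_zero_of_add (m n : ℕ) (h : coeffs z (n + m) = 0) : coeffs z n = 0 := by
    induction m with
    | zero => exact h
    | succ m ih => exact ih (by rw [coeff_eq_smul, add_assoc, h, smul_zero])
  obtain ⟨N, hN⟩ := Finset.exists_nat_subset_range (coeffs z).support
  rw [← coeffs.map_eq_zero_iff]
  ext n
  refine coeff_eq_zero_of_add N n (Finsupp.notMem_support_iff.mp fun h => ?_)
  have := Finset.mem_range.mp (hN h)
  omega

end

variable {A : Type u} [CommRing A]

theorem hasProjectiveDimensionLE_one_of_projective (M : ModuleCat.{u} A[X]) [Module A M]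
    [IsScalarTower A A[X] M] [Module.Projective A M] : HasProjectiveDimensionLE M 1 := by
  let S : ShortComplex (ModuleCat.{u} A[X]) :=
    ModuleCat.shortComplexOfCompEqZero (polynomialTensorDiff A M) (polynomialTensorAction A M)
      polynomialTensor_exact.linearMap_comp_eq_zero
  have hS : S.ShortExact :=
    { exact := ModuleCat.shortComplex_exact _ polynomialTensor_exact
      mono_f := (ModuleCat.mono_iff_injective _).mpr polynomialTensorDiff_injective
      epi_g := (ModuleCat.epi_iff_surjective _).mpr polynomialTensorAction_surjective }
  have h₁ : Projective S.X₁ := (IsProjective.iff_projective _).mp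
    (inferInstanceAs (Module.Projective A[X] (TensorProduct A A[X] M)))
  have h₂ : Projective S.X₂ := h₁
  exact hS.hasProjectiveDimensionLT_X₃ 1 inferInstance inferInstance

theorem projective_restrictScalars_C (M : ModuleCat.{u} A[X]) [Projective M] :
    Projective ((ModuleCat.restrictScalars (C : A →+* A[X])).obj M) := by
  let _ : Module A M := Module.compHom M (C : A →+* A[X])
  have : IsScalarTower A A[X] M := IsScalarTower.of_algebraMap_smul fun _ _ => rfl
  have : Module.Projective A[X] M := (IsProjective.iff_projective _).mpr inferInstance
  obtain ⟨s, hs⟩ := (Module.projective_def' (R := A[X]) (P := M)).mp this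
  have : Module.Projective A M := .of_split (s.restrictScalars A)
    ((Finsupp.linearCombination A[X] id).restrictScalars A)
    (LinearMap.ext fun x => LinearMap.congr_fun hs x)
  exact (IsProjective.iff_projective _).mp (inferInstanceAs (Module.Projective A M))

theorem hasProjectiveDimensionLE_succ_of_restrictScalars_C (n : ℕ) (M : ModuleCat.{u} A[X])
    (h : HasProjectiveDimensionLE ((ModuleCat.restrictScalars (C : A →+* A[X])).obj M) n) :
    HasProjectiveDimensionLE M (n + 1) := by
  induction n generalizing M with
  | zero =>
    let _ : Module A M := Module.compHom M (C : A →+* A[X])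
    have : IsScalarTower A A[X] M := IsScalarTower.of_algebraMap_smul fun _ _ => rfl
    have : Module.Projective A M :=
      (IsProjective.iff_projective _).mpr ((projective_iff_hasProjectiveDimensionLE_zero _).mpr h)
    exact hasProjectiveDimensionLE_one_of_projective M
  | succ n ih =>
    have hS := M.shortExact_projectiveShortComplex
    have hS' := hS.map_of_exact (ModuleCat.restrictScalars (C : A →+* A[X]))
    rw [HasProjectiveDimensionLE, hS.hasProjectiveDimensionLT_X₃_iff (n + 1) inferInstance]
    exact ih _ ((hS'.hasProjectiveDimensionLT_X₃_iff n (projective_restrictScalars_C _)).mp h)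

end PolynomialExtension

section MvPolynomialExtension

open MvPolynomial

variable {k : Type u} [CommRing k] {n : ℕ}

theorem finSuccEquiv_symm_C (r : MvPolynomial (Fin n) k) :
    (finSuccEquiv k n).symm (Polynomial.C r) = rename Fin.succ r := by
  induction r using MvPolynomial.induction_on with
  | C c => simp [AlgEquiv.symm_apply_eq, finSuccEquiv_apply]
  | add p q hp hq => rw [Polynomial.C_add, map_add, map_add, hp, hq]
  | mul_X p i hp =>
    rw [Polynomial.C_mul, map_mul, map_mul, hp, ← finSuccEquiv_X_succ, AlgEquiv.symm_apply_apply,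
      rename_X]

theorem hasProjectiveDimensionLE_succ_of_restrictScalars_rename (m : ℕ)
    (M : ModuleCat.{u} (MvPolynomial (Fin (n + 1)) k))
    (h : HasProjectiveDimensionLE ((ModuleCat.restrictScalars
      (rename Fin.succ : MvPolynomial (Fin n) k →ₐ[k] MvPolynomial (Fin (n + 1)) k).toRingHom).obj
        M) m) :
    HasProjectiveDimensionLE M (m + 1) := by
  let e := (finSuccEquiv k n).toRingEquiv
  let N : ModuleCat.{u} (Polynomial (MvPolynomial (Fin n) k)) :=
    (ModuleCat.restrictScalars e.symm.toRingHom).obj M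
  have hC : e.symm.toRingHom.comp Polynomial.C =
      (rename Fin.succ : MvPolynomial (Fin n) k →ₐ[k] _).toRingHom :=
    RingHom.ext finSuccEquiv_symm_C
  have hN : HasProjectiveDimensionLE ((ModuleCat.restrictScalars Polynomial.C).obj N) m := by
    rw [← hC] at h
    exact h
  have hN' := hasProjectiveDimensionLE_succ_of_restrictScalars_C m N hN
  let _ := RingHomInvPair.of_ringEquiv e.symm
  let _ := RingHomInvPair.of_ringEquiv e.symm.symm
  refine ModuleCat.hasProjectiveDimensionLE_of_semiLinearEquiv (M := N) e.symm ?_ (m + 1)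
  exact LinearEquiv.ofBijective (⟨⟨id, fun _ _ => rfl⟩, fun r x => rfl⟩) Function.bijective_id

end MvPolynomialExtension

section HilbertSyzygy

theorem projective_of_isSemisimpleRing {R : Type u} [Ring R] [IsSemisimpleRing R]
    (M : ModuleCat.{u} R) : Projective M :=
  (IsProjective.iff_projective M).mp (Module.projective_of_isSemisimpleRing R M)

theorem hasProjectiveDimensionLE_mvPolynomial {k : Type u} [Field k] (n : ℕ)
    (M : ModuleCat.{u} (MvPolynomial (Fin n) k)) : HasProjectiveDimensionLE M n := by
  induction n with
  | zero =>
    have : IsSemisimpleRing (MvPolynomial (Fin 0) k) :=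
      (MvPolynomial.isEmptyRingEquiv k (Fin 0)).symm.isSemisimpleRing
    have := projective_of_isSemisimpleRing M
    infer_instance
  | succ n ih => exact hasProjectiveDimensionLE_succ_of_restrictScalars_rename n M (ih _)

end HilbertSyzygy

section RegularSequence

open RingTheory.Sequence

theorem projectiveDimension_localizedModule_quotient {R : Type u} [CommRing R] (S : Submonoid R)
    (I : Ideal R) :
    projectiveDimension ((ModuleCat.of R (R ⧸ I)).localizedModule S) =
      projectiveDimension (ModuleCat.of (Localization S)
        (Localization S ⧸ I.map (algebraMap R (Localization S)))) := by
  rw [← Ideal.localized'_eq_map (Localization S) S]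
  exact ModuleCat.projectiveDimension_eq_of_linearEquiv
    ((Shrink.linearEquiv _ _).trans
      ((IsLocalizedModule.linearEquiv S (LocalizedModule.mkLinearMap S (R ⧸ I))
        (Submodule.toLocalizedQuotient' (Localization S) S
          (Algebra.linearMap R (Localization S)) I)).extendScalarsOfIsLocalization S _))

theorem length_le_projectiveDimension_quotient_ofList {R : Type u} [CommRing R]
    [IsNoetherianRing R] {rs : List R} (reg : IsRegular R rs) :
    (rs.length : WithBot ℕ∞) ≤ projectiveDimension (ModuleCat.of R (R ⧸ Ideal.ofList rs)) := by
  have ne_top : Ideal.ofList rs ≠ ⊤ := by simpa using reg.2.symm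
  obtain ⟨m, hm, hle⟩ := Ideal.exists_le_maximal _ ne_top
  have reg' : IsRegular (Localization.AtPrime m)
      (rs.map (algebraMap R (Localization.AtPrime m))) :=
    reg.1.isRegular_of_isLocalization_of_mem _ m fun r hr => hle (Ideal.subset_span hr)
  calc (rs.length : WithBot ℕ∞)
      = projectiveDimension (ModuleCat.of (Localization.AtPrime m) (Localization.AtPrime m ⧸
          (Ideal.ofList rs).map (algebraMap R (Localization.AtPrime m)))) := by
        rw [Ideal.map_ofList, ← ModuleCat.projectiveDimension_eq_of_linearEquiv
          (M := ModuleCat.of _ (Shrink.{u} _)) (Shrink.linearEquiv _ _),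
          ModuleCat.projectiveDimension_quotient_eq_length _ reg', List.length_map]
    _ = projectiveDimension
          ((ModuleCat.of R (R ⧸ Ideal.ofList rs)).localizedModule m.primeCompl) :=
        (projectiveDimension_localizedModule_quotient m.primeCompl _).symm
    _ ≤ projectiveDimension (ModuleCat.of R (R ⧸ Ideal.ofList rs)) :=
        ModuleCat.projectiveDimension_le_projectiveDimension_of_isLocalizedModule _ _

open MvPolynomial

theorem mem_span_X_image_of_X_mul_mem {σ k : Type*} [CommRing k] {s : Set σ} {i : σ} (hi : i ∉ s)
    {f : MvPolynomial σ k} (h : X i * f ∈ Ideal.span (X '' s)) : f ∈ Ideal.span (X '' s) := by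
  classical
  rw [mem_ideal_span_X_image] at h ⊢
  intro m hm
  obtain ⟨j, hj, hj'⟩ := h (Finsupp.single i 1 + m) (by
    rwa [mem_support_iff, coeff_X_mul, ← mem_support_iff])
  have hij : i ≠ j := fun h => hi (h ▸ hj)
  exact ⟨j, hj, by simpa [Finsupp.single_apply, hij] using hj'⟩

theorem ofList_map_X {σ k : Type*} [CommRing k] (l : List σ) :
    Ideal.ofList (l.map X) = Ideal.span (X '' {i | i ∈ l} : Set (MvPolynomial σ k)) := by
  simp only [Ideal.ofList, List.mem_map]
  rfl

theorem isWeaklyRegular_map_X {σ k : Type*} [CommRing k] {l : List σ} (hl : l.Nodup) :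
    IsWeaklyRegular (MvPolynomial σ k) (l.map (X : σ → MvPolynomial σ k)) := by
  refine (isWeaklyRegular_iff _ _).mpr fun i hi => ?_
  rw [List.length_map] at hi
  have notMem : l[i] ∉ {j | j ∈ l.take i} := by
    intro h
    obtain ⟨j, hj, hij⟩ := List.mem_take_iff_getElem.mp h
    have := (hl.getElem_inj_iff).mp hij
    omega
  rw [← List.map_take, ofList_map_X, smul_eq_mul, Ideal.mul_top, List.getElem_map,
    isSMulRegular_quotient_iff_mem_of_smul_mem]
  exact fun f hf => mem_span_X_image_of_X_mul_mem notMem hf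

theorem idealOfVars_eq_ker_constantCoeff (σ k : Type*) [CommRing k] :
    idealOfVars σ k = RingHom.ker (constantCoeff : MvPolynomial σ k →+* k) := by
  ext f
  rw [← pow_one (idealOfVars σ k), mem_pow_idealOfVars_iff', RingHom.mem_ker, constantCoeff_eq]
  simp [Finsupp.degree_eq_zero_iff]

theorem ofList_map_X_toList_univ (σ k : Type*) [Fintype σ] [CommRing k] :
    Ideal.ofList (Finset.univ.toList.map X) = idealOfVars σ k := by
  simp [ofList_map_X, idealOfVars]

theorem isRegular_map_X_toList_univ (σ k : Type*) [Fintype σ] [CommRing k] [Nontrivial k] :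
    IsRegular (MvPolynomial σ k) (Finset.univ.toList.map (X : σ → MvPolynomial σ k)) := by
  refine ⟨isWeaklyRegular_map_X (Finset.nodup_toList _), ?_⟩
  rw [ofList_map_X_toList_univ, smul_eq_mul, Ideal.mul_top, idealOfVars_eq_ker_constantCoeff]
  exact (RingHom.ker_ne_top _).symm

theorem card_le_projectiveDimension_quotient_idealOfVars (σ k : Type*) [Fintype σ] [CommRing k]
    [IsNoetherianRing k] [Nontrivial k] :
    (Fintype.card σ : WithBot ℕ∞) ≤ projectiveDimension
      (ModuleCat.of (MvPolynomial σ k) (MvPolynomial σ k ⧸ idealOfVars σ k)) := by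
  have h := length_le_projectiveDimension_quotient_ofList (isRegular_map_X_toList_univ σ k)
  rwa [ofList_map_X_toList_univ, List.length_map, Finset.length_toList, Finset.card_univ] at h

end RegularSequence

section Socle

open MvPolynomial

theorem shortExact_cokernel {C : Type*} [Category* C] [Abelian C] {X Y : C} (f : X ⟶ Y) [Mono f] :
    (ShortComplex.mk f (Limits.cokernel.π f) (Limits.cokernel.condition f)).ShortExact :=
  { exact := ShortComplex.exact_cokernel f }

instance isMaximal_idealOfVars (σ k : Type*) [Field k] : (idealOfVars σ k).IsMaximal := by
  rw [idealOfVars_eq_ker_constantCoeff]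
  exact RingHom.ker_isMaximal_of_surjective _ fun c => ⟨C c, constantCoeff_C _ c⟩

theorem ker_toSpanSingleton_eq_idealOfVars {σ k M : Type*} [Field k] [AddCommGroup M]
    [Module (MvPolynomial σ k) M] {v : M} (hv : v ≠ 0)
    (h : ∀ i, (X i : MvPolynomial σ k) • v = 0) :
    LinearMap.ker (LinearMap.toSpanSingleton (MvPolynomial σ k) M v) = idealOfVars σ k := by
  refine ((isMaximal_idealOfVars σ k).eq_of_le ?_ ?_).symm
  · refine fun htop => hv ?_
    rw [← one_smul (MvPolynomial σ k) v]
    exact (Ideal.eq_top_iff_one _).mp htop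
  · rw [Ideal.span_le]
    rintro _ ⟨i, rfl⟩
    exact h i

variable {k : Type u} [Field k] {n : ℕ}

theorem le_projectiveDimension_of_X_smul_eq_zero {M : ModuleCat.{u} (MvPolynomial (Fin n) k)}
    {v : M} (hv : v ≠ 0) (h : ∀ i, (X i : MvPolynomial (Fin n) k) • v = 0) :
    (n : WithBot ℕ∞) ≤ projectiveDimension M := by
  have hker := ker_toSpanSingleton_eq_idealOfVars hv h
  let f := ModuleCat.ofHom ((idealOfVars (Fin n) k).liftQ (LinearMap.toSpanSingleton _ M v) hker.ge)
  have : Mono f := (ModuleCat.mono_iff_ker_eq_bot f).mpr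
    (Submodule.ker_liftQ_eq_bot' _ _ hker.symm)
  have hle := card_le_projectiveDimension_quotient_idealOfVars (Fin n) k
  rw [Fintype.card_fin, projectiveDimension_ge_iff] at hle
  rw [projectiveDimension_ge_iff]
  exact fun hM => hle ((shortExact_cokernel f).hasProjectiveDimensionLT_X₁ n hM
    (hasProjectiveDimensionLE_mvPolynomial n _))

theorem le_projectiveDimension_of_mono {M N : ModuleCat.{u} (MvPolynomial (Fin (n + 1)) k)}
    (f : M ⟶ N) [Mono f] (hN : HasProjectiveDimensionLE N n) {v : N}
    (hv : v ∉ LinearMap.range f.hom)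
    (h : ∀ i, (X i : MvPolynomial (Fin (n + 1)) k) • v ∈ LinearMap.range f.hom) :
    (n : WithBot ℕ∞) ≤ projectiveDimension M := by
  have mem_range_iff (w : N) : w ∈ LinearMap.range f.hom ↔ Limits.cokernel.π f w = 0 :=
    ((ShortComplex.ShortExact.moduleCat_exact_iff_function_exact _).mp
      (shortExact_cokernel f).exact w).symm
  have hcoker : ((n + 1 : ℕ) : WithBot ℕ∞) ≤ projectiveDimension (Limits.cokernel f) := by
    refine le_projectiveDimension_of_X_smul_eq_zero (v := Limits.cokernel.π f v)
      (fun h0 => hv ((mem_range_iff v).mpr h0)) fun i => ?_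
    rw [← map_smul]
    exact (mem_range_iff _).mp (h i)
  rw [projectiveDimension_ge_iff] at hcoker ⊢
  exact fun hM => hcoker ((shortExact_cokernel f).hasProjectiveDimensionLT_X₃ n hM hN)

end Socle

section MonoidAlgebra

open MvPolynomial

theorem free_of_basis_smul {A S M ι κ : Type*} [CommSemiring A] [Semiring S] [Algebra A S]
    [AddCommMonoid M] [Module A M] [Module S M] [IsScalarTower A S M] (c : Module.Basis ι A S)
    (b : Module.Basis (κ × ι) A M) (v : κ → M) (h : ∀ w i, c i • v w = b (w, i)) :
    Module.Free S M := by
  let L : (κ →₀ S) →ₗ[S] M := Finsupp.linearCombination S v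
  let e := (Finsupp.basis fun _ : κ => c).equiv b (Equiv.sigmaEquivProd κ ι)
  have hL : L.restrictScalars A = e := by
    refine (Finsupp.basis fun _ : κ => c).ext fun ⟨w, i⟩ => ?_
    have hb : (Finsupp.basis fun _ : κ => c) ⟨w, i⟩ = Finsupp.single w (c i) := by
      simp only [Finsupp.coe_basis]
    rw [LinearEquiv.coe_coe, Module.Basis.equiv_apply, LinearMap.restrictScalars_apply, hb,
      Finsupp.linearCombination_single, h, Equiv.sigmaEquivProd_apply]
  have hbij : Function.Bijective (L.restrictScalars A) := hL ▸ e.bijective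
  exact Module.Free.of_equiv (LinearEquiv.ofBijective L hbij)

theorem bijective_iterate_compl_range {T : Type*} {φ : T → T} (hφ : Function.Injective φ)
    {r : T → ℕ} (hr : ∀ t, r t < r (φ t)) :
    Function.Bijective fun p : ↥(Set.range φ)ᶜ × ℕ => φ^[p.2] p.1 := by
  constructor
  · rintro ⟨⟨t, ht⟩, m⟩ ⟨⟨t', ht'⟩, m'⟩ h
    induction m generalizing m' with
    | zero =>
      cases m' with
      | zero => simpa using h
      | succ m' => exact absurd ⟨_, (h.trans (Function.iterate_succ_apply' _ _ _)).symm⟩ ht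
    | succ m ih =>
      cases m' with
      | zero => exact absurd ⟨_, ((Function.iterate_succ_apply' _ _ _).symm.trans h)⟩ ht'
      | succ m' =>
        simp only [Function.iterate_succ_apply'] at h
        simpa using ih m' (hφ h)
  · intro t
    induction hm : r t using Nat.strong_induction_on generalizing t with
    | _ m ih =>
      by_cases ht : t ∈ Set.range φ
      · obtain ⟨s, rfl⟩ := ht
        obtain ⟨⟨w, i⟩, rfl⟩ := ih (r s) (hm ▸ hr s) s rfl
        exact ⟨(w, i + 1), Function.iterate_succ_apply' _ _ _⟩
      · exact ⟨(⟨t, ht⟩, 0), rfl⟩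

variable (k : Type u) [CommRing k] {N N' : Type} [AddCommMonoid N] [AddCommMonoid N'] {n : ℕ}

/-- The monoid algebra `k[N]` as a module over `k[x_1, …, x_n]` through `x_i ↦ t^{g_i}`. For `N`
a submonoid `S` of `ℕ^d` this is, by definition, `AffineSemigroup.semigroupRingModule k S g`. -/
noncomputable def monoidAlgebraModule (g : Fin n → N) : ModuleCat.{u} (MvPolynomial (Fin n) k) :=
  (ModuleCat.restrictScalars (aeval fun i => AddMonoidAlgebra.single (g i) (1 : k) :
      MvPolynomial (Fin n) k →ₐ[k] AddMonoidAlgebra k N).toRingHom).obj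
    (ModuleCat.of (AddMonoidAlgebra k N) (AddMonoidAlgebra k N))

variable {k}

theorem X_smul_monoidAlgebraModule (g : Fin n → N) (i : Fin n) (x : AddMonoidAlgebra k N) :
    (X i : MvPolynomial (Fin n) k) • (show monoidAlgebraModule k g from x) =
      (AddMonoidAlgebra.single (g i) (1 : k) * x :) := by
  change aeval _ (X i) * x = _
  rw [aeval_X]

theorem X_pow_smul_single (g : Fin n → N) (i : Fin n) (m : ℕ) (t : N) :
    (X i ^ m : MvPolynomial (Fin n) k) •
        (show monoidAlgebraModule k g from AddMonoidAlgebra.single t 1) =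
      AddMonoidAlgebra.single ((g i + ·)^[m] t) (1 : k) := by
  induction m with
  | zero => exact one_smul _ _
  | succ m ih =>
    rw [pow_succ', mul_smul, ih, X_smul_monoidAlgebraModule, AddMonoidAlgebra.single_mul_single,
      one_mul, Function.iterate_succ_apply']

theorem free_monoidAlgebraModule [IsCancelAdd N] (g : Fin 1 → N) (r : N →+ ℕ)
    (hr : r (g 0) ≠ 0) :
    Module.Free (MvPolynomial (Fin 1) k) (monoidAlgebraModule k g) := by
  let _ : Module k (monoidAlgebraModule k g) :=
    Module.compHom _ (C : k →+* MvPolynomial (Fin 1) k)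
  have : IsScalarTower k (MvPolynomial (Fin 1) k) (monoidAlgebraModule k g) :=
    IsScalarTower.of_algebraMap_smul fun _ _ => rfl
  let E := Equiv.ofBijective _ (bijective_iterate_compl_range (add_right_injective (g 0))
    fun t => (Nat.lt_add_of_pos_left (Nat.pos_of_ne_zero hr)).trans_eq (map_add r _ t).symm)
  let L : AddMonoidAlgebra k N ≃ₗ[k] monoidAlgebraModule k g :=
    { AddEquiv.refl (AddMonoidAlgebra k N) with
      map_smul' := fun c x => by
        change c • x = aeval _ (C c) * x
        rw [aeval_C, ← Algebra.smul_def] }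
  let c := (basisMonomials (Fin 1) k).reindex
    (Finsupp.equivFunOnFinite.trans (Equiv.funUnique (Fin 1) ℕ))
  refine free_of_basis_smul c (((AddMonoidAlgebra.basis N k).map L).reindex E.symm)
    (fun w => L (AddMonoidAlgebra.single w 1)) fun w m => ?_
  have hc : c m = X 0 ^ m := by
    rw [Module.Basis.reindex_apply, coe_basisMonomials, X_pow_eq_monomial]
    exact congrArg (fun q => monomial q (1 : k)) (Finsupp.ext fun i => by
      rw [Subsingleton.elim i 0, Finsupp.single_eq_same]; rfl)
  rw [hc, Module.Basis.reindex_apply, Equiv.symm_symm, Module.Basis.map_apply,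
    AddMonoidAlgebra.basis_apply]
  exact X_pow_smul_single g 0 m w

theorem hasProjectiveDimensionLE_monoidAlgebraModule [IsCancelAdd N] (g : Fin (n + 1) → N)
    (r : N →+ ℕ) (hr : r (g (Fin.last n)) ≠ 0) :
    HasProjectiveDimensionLE (monoidAlgebraModule k g) n := by
  induction n with
  | zero =>
    have := free_monoidAlgebraModule g r hr (k := k)
    rw [← projective_iff_hasProjectiveDimensionLE_zero, ← IsProjective.iff_projective]
    exact Module.Projective.of_free
  | succ n ih =>
    refine hasProjectiveDimensionLE_succ_of_restrictScalars_rename n _ ?_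
    have hg : (aeval fun i => AddMonoidAlgebra.single (g i) 1 :
          MvPolynomial (Fin (n + 2)) k →ₐ[k] AddMonoidAlgebra k N).comp (rename Fin.succ) =
        aeval fun i => AddMonoidAlgebra.single ((g ∘ Fin.succ) i) 1 := by
      ext i
      simp only [AlgHom.comp_apply, rename_X, aeval_X, Function.comp_apply]
    have h := ih (g ∘ Fin.succ) hr
    rw [monoidAlgebraModule, ← hg] at h
    exact h

variable (k) in
/-- The map `k[N] → k[N']` induced by `f : N →+ N'`, as a map of `k[x_1, …, x_n]`-modules. -/
noncomputable def monoidAlgebraModuleMap (f : N →+ N') (g : Fin n → N) :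
    monoidAlgebraModule k g ⟶ monoidAlgebraModule k (f ∘ g) :=
  let φ := AddMonoidAlgebra.mapDomainAlgHom k k f
  ModuleCat.ofHom (X := monoidAlgebraModule k g) (Y := monoidAlgebraModule k (f ∘ g))
    { toFun := φ
      map_add' := map_add φ
      map_smul' := fun p x => by
        have hφ : φ.comp (aeval fun i => AddMonoidAlgebra.single (g i) (1 : k)) =
            aeval fun i => AddMonoidAlgebra.single ((f ∘ g) i) (1 : k) := by
          ext i
          simp [φ]
        have h := map_mul φ (aeval (fun i => AddMonoidAlgebra.single (g i) (1 : k)) p) x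
        rwa [← AlgHom.comp_apply, hφ] at h }

theorem mono_monoidAlgebraModuleMap {f : N →+ N'} (hf : Function.Injective f) (g : Fin n → N) :
    Mono (monoidAlgebraModuleMap k f g) :=
  (ModuleCat.mono_iff_injective _).mpr (AddMonoidAlgebra.mapDomain_injective hf)

theorem single_mem_range_monoidAlgebraModuleMap_iff [Nontrivial k] (f : N →+ N') (g : Fin n → N)
    (v : N') :
    (show monoidAlgebraModule k (f ∘ g) from AddMonoidAlgebra.single v 1) ∈
      LinearMap.range (monoidAlgebraModuleMap k f g).hom ↔ v ∈ AddMonoidHom.mrange f := by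
  constructor
  · rintro ⟨x, hx⟩
    by_contra hv
    have hcoeff : Finsupp.mapDomain f (show AddMonoidAlgebra k N from x).coeff =
        Finsupp.single v 1 := congrArg AddMonoidAlgebra.coeff hx
    have h0 := Finsupp.mapDomain_of_notMem_range
      (show AddMonoidAlgebra k N from x).coeff v hv
    rw [hcoeff, Finsupp.single_eq_same] at h0
    exact one_ne_zero h0
  · rintro ⟨t, rfl⟩
    exact ⟨AddMonoidAlgebra.single t 1, AddMonoidAlgebra.mapDomain_single⟩

theorem le_projectiveDimension_monoidAlgebraModule {k : Type u} [Field k] [IsCancelAdd N']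
    {f : N →+ N'} (hf : Function.Injective f) {g : Fin (n + 1) → N} {r : N' →+ ℕ}
    (hr : r (f (g (Fin.last n))) ≠ 0) {v : N'} (hv : v ∉ AddMonoidHom.mrange f)
    (h : ∀ i, f (g i) + v ∈ AddMonoidHom.mrange f) :
    (n : WithBot ℕ∞) ≤ projectiveDimension (monoidAlgebraModule k g) := by
  have := mono_monoidAlgebraModuleMap hf g (k := k)
  refine le_projectiveDimension_of_mono (monoidAlgebraModuleMap k f g)
    (hasProjectiveDimensionLE_monoidAlgebraModule (f ∘ g) r hr)
    ((single_mem_range_monoidAlgebraModuleMap_iff f g v).not.mpr hv) fun i => ?_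
  rw [X_smul_monoidAlgebraModule, AddMonoidAlgebra.single_mul_single, one_mul]
  exact (single_mem_range_monoidAlgebraModuleMap_iff f g _).mpr (h i)

end MonoidAlgebra

namespace AffineSemigroup

variable {k : Type u} [Field k] {d n : ℕ} {S : AddSubmonoid (Fin d → ℕ)}

/-- The sum of the coordinates, the rank function for the translations of `ℕ^d`. -/
def coordinateSum (d : ℕ) : (Fin d → ℕ) →+ ℕ :=
  ∑ i, Pi.evalAddMonoidHom (fun _ => ℕ) i

theorem coordinateSum_ne_zero {x : Fin d → ℕ} (hx : x ≠ 0) : coordinateSum d x ≠ 0 := by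
  obtain ⟨i, hi⟩ := Function.ne_iff.mp hx
  rw [coordinateSum, AddMonoidHom.finsetSum_apply]
  exact fun h => hi (Finset.sum_eq_zero_iff.mp h i (Finset.mem_univ i))

theorem projectiveDimension_semigroupRingModule {g : Fin (n + 1) → S} (hg : ∀ i, g i ≠ 0)
    (hS : (pseudoFrobenius S).Nonempty) : projectiveDimension (semigroupRingModule k S g) = n := by
  obtain ⟨f, ⟨-, hf⟩, hfS⟩ := hS
  have hr := coordinateSum_ne_zero (Subtype.coe_ne_coe.mpr (hg (Fin.last n)))
  have mem_iff (x : Fin d → ℕ) : x ∈ AddMonoidHom.mrange S.subtype ↔ x ∈ S := by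
    rw [AddSubmonoid.mrange_subtype]
  refine le_antisymm ((projectiveDimension_le_iff _ n).mpr ?_) ?_
  · exact hasProjectiveDimensionLE_monoidAlgebraModule g ((coordinateSum d).comp S.subtype) hr
  · refine le_projectiveDimension_monoidAlgebraModule S.subtype_injective hr
      ((mem_iff f).not.mpr hf) fun i => (mem_iff _).mpr ?_
    rw [add_comm]
    exact hfS _ (g i).2 (Subtype.coe_ne_coe.mpr (hg i))

theorem minimalGenerators_nonempty (hS : (pseudoFrobenius S).Nonempty) :
    (minimalGenerators S).Nonempty := by
  obtain ⟨f, ⟨hcone, hf⟩, -⟩ := hS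
  rw [Set.nonempty_iff_ne_empty]
  intro h
  have hbot : S = ⊥ := by rw [← closure_minimalGenerators S, h, AddSubmonoid.closure_empty]
  subst hbot
  refine hf (AddSubmonoid.mem_bot.mpr (funext fun i => ?_))
  have h0 : (fun i => (f i : ℚ)) = 0 := by
    simpa [cone, ← Pi.zero_def] using hcone
  exact Nat.cast_eq_zero.mp (congrFun h0 i)

theorem isMPD_of_pseudoFrobenius_nonempty (hfin : (minimalGenerators S).Finite)
    (hS : (pseudoFrobenius S).Nonempty) : IsMPD k S := by
  obtain ⟨n, g, hg, hrange⟩ := hfin.fin_param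
  have hgS (i) : g i ∈ minimalGenerators S := hrange ▸ Set.mem_range_self i
  obtain _ | n := n
  · exact absurd (hrange ▸ Set.range_eq_empty g) (minimalGenerators_nonempty hS).ne_empty
  · refine ⟨n + 1, fun i => ⟨g i, (hgS i).1⟩, fun i j h => hg (congrArg Subtype.val h),
      (isMinimalGeneratingSet_iff S _).mpr hrange, ?_⟩
    rw [projectiveDimension_semigroupRingModule
      (fun i => Subtype.coe_ne_coe.mp (hgS i).2.1) hS]
    rfl

end AffineSemigroup

namespace AffineSemigroup

/-- The point `m (2, 2) + i (a, 0) + j (0, a ^ p)` of `ℕ²`. The elements of `S_{a,p}` are the points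
that can be written in this form with `m ≤ i + j`. -/
def point (a p m i j : ℕ) : Fin 2 → ℕ :=
  ![2 * m + a * i, 2 * m + a ^ p * j]

variable {a p m i j : ℕ}

theorem point_add (m' i' j' : ℕ) :
    point a p m i j + point a p m' i' j' = point a p (m + m') (i + i') (j + j') := by
  simp only [point, Matrix.cons_add_cons, Matrix.empty_add_empty]
  congr 1
  · ring
  · congr 1
    ring

theorem point_zero : point a p 0 0 0 = 0 := by
  simp [point]

theorem vec_left_eq_point : ![a, 0] = point a p 0 1 0 := by
  simp [point]

theorem vec_right_eq_point : ![0, a ^ p] = point a p 0 0 1 := by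
  simp [point]

theorem vec_lower_eq_point : ![a + 2, 2] = point a p 1 1 0 := by
  simp [point, add_comm]

theorem vec_upper_eq_point : ![2, 2 + a ^ p] = point a p 1 0 1 := by
  simp [point]

theorem smul_add_smul_eq_point (α α' : ℕ) :
    α • ![a + 2, 2] + α' • ![2, 2 + a ^ p] = point a p (α + α') α α' := by
  simp only [point, Matrix.smul_cons, Matrix.smul_empty, smul_eq_mul, Matrix.cons_add_cons,
    Matrix.empty_add_empty]
  congr 1
  · ring
  · congr 1
    ring

theorem point_mem_Sap (h : m ≤ i + j) : point a p m i j ∈ Sap a p := by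
  obtain ⟨α, α', β, β', rfl, rfl, rfl⟩ : ∃ α α' β β', m = α + α' ∧ i = α + β ∧ j = α' + β' :=
    ⟨min m i, m - min m i, i - min m i, j - (m - min m i), by omega, by omega, by omega⟩
  have hpoint : point a p (α + α') (α + β) (α' + β') =
      α • ![a + 2, 2] + α' • ![2, 2 + a ^ p] + (β • ![a, 0] + β' • ![0, a ^ p]) := by
    rw [smul_add_smul_eq_point, ← Nat.add_zero (α + α'), ← point_add]
    simp [point, mul_comm]
  rw [hpoint]
  refine add_mem (add_mem ?_ ?_) (add_mem ?_ ?_) <;>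
    exact nsmul_mem (AddSubmonoid.subset_closure (by simp)) _

theorem exists_point_eq_of_mem_Sap {x : Fin 2 → ℕ} (hx : x ∈ Sap a p) :
    ∃ m i j, m ≤ i + j ∧ point a p m i j = x := by
  induction hx using AddSubmonoid.closure_induction with
  | mem x hx =>
    rcases hx with rfl | rfl | rfl | rfl
    · exact ⟨0, 1, 0, by omega, vec_left_eq_point.symm⟩
    · exact ⟨0, 0, 1, by omega, vec_right_eq_point.symm⟩
    · exact ⟨1, 1, 0, by omega, vec_lower_eq_point.symm⟩
    · exact ⟨1, 0, 1, by omega, vec_upper_eq_point.symm⟩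
  | zero => exact ⟨0, 0, 0, by omega, point_zero⟩
  | add x y _ _ hx hy =>
    obtain ⟨m, i, j, h, rfl⟩ := hx
    obtain ⟨m', i', j', h', rfl⟩ := hy
    exact ⟨m + m', i + i', j + j', by omega, (point_add m' i' j').symm⟩

theorem point_add_pow_mul (hp : 1 ≤ p) (c : ℕ) :
    point a p (m + a ^ p * c) i j = point a p m (i + 2 * a ^ (p - 1) * c) (j + 2 * c) := by
  obtain ⟨q, rfl⟩ := Nat.exists_eq_add_of_le' hp
  simp only [point, Nat.add_sub_cancel]
  congr 1
  · ring
  · congr 1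
    ring

theorem exists_of_point_eq (ha : Odd a) (hp : 1 ≤ p) (hm : m < a ^ p) {m' i' j' : ℕ}
    (h : point a p m i j = point a p m' i' j') :
    ∃ c, m' = m + a ^ p * c ∧ i = i' + 2 * a ^ (p - 1) * c ∧ j = j' + 2 * c := by
  have h1 : 2 * m + a ^ p * j = 2 * m' + a ^ p * j' := congrFun h 1
  have hmod : 2 * m ≡ 2 * m' [MOD a ^ p] := by
    simpa [Nat.ModEq] using congrArg (· % a ^ p) h1
  have hmod' : m % a ^ p = m' % a ^ p :=
    Nat.ModEq.cancel_left_of_coprime (ha.pow.coprime_two_left.symm) hmod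
  obtain ⟨c, rfl⟩ : ∃ c, m' = m + a ^ p * c :=
    ⟨m' / a ^ p, by rw [← Nat.mod_eq_of_lt hm, hmod', Nat.mod_add_div]⟩
  rw [point_add_pow_mul hp] at h
  refine ⟨c, rfl, Nat.eq_of_mul_eq_mul_left ha.pos (Nat.add_left_cancel (congrFun h 0)),
    Nat.eq_of_mul_eq_mul_left ha.pow.pos (Nat.add_left_cancel (congrFun h 1))⟩

theorem excess_le_of_point_eq (ha : Odd a) (hp : 1 ≤ p) (hm : m < a ^ p) {m' i' j' : ℕ}
    (h : point a p m i j = point a p m' i' j') : i' + j' + m ≤ i + j + m' := by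
  obtain ⟨c, rfl, rfl, rfl⟩ := exists_of_point_eq ha hp hm h
  omega

theorem exists_lt_pow_point_eq_of_mem_Sap (ha : 0 < a) (hp : 1 ≤ p) {x : Fin 2 → ℕ}
    (hx : x ∈ Sap a p) : ∃ m i j, m < a ^ p ∧ point a p m i j = x := by
  obtain ⟨m, i, j, -, rfl⟩ := exists_point_eq_of_mem_Sap hx
  exact ⟨m % a ^ p, _, _, Nat.mod_lt _ (pow_pos ha p),
    (point_add_pow_mul (i := i) (j := j) hp (m / a ^ p)).symm.trans (by rw [Nat.mod_add_div])⟩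

theorem point_mem_Sap_iff (ha : Odd a) (hp : 1 ≤ p) (hm : m < a ^ p) :
    point a p m i j ∈ Sap a p ↔ m ≤ i + j := by
  refine ⟨fun h => ?_, point_mem_Sap⟩
  obtain ⟨m', i', j', h', heq⟩ := exists_point_eq_of_mem_Sap h
  have := excess_le_of_point_eq ha hp hm heq.symm
  omega

theorem point_mem_apery_iff (ha : Odd a) (hp : 1 ≤ p) (hm : m < a ^ p) :
    point a p m i j ∈ apery (Sap a p) {![a, 0], ![0, a ^ p]} ↔ m = i + j := by
  have add_left (m i j : ℕ) : point a p m i j + ![a, 0] = point a p m (i + 1) j := by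
    rw [vec_left_eq_point, point_add]
    rfl
  have add_right (m i j : ℕ) : point a p m i j + ![0, a ^ p] = point a p m i (j + 1) := by
    rw [vec_right_eq_point, point_add]
    rfl
  constructor
  · rintro ⟨hS, hE⟩
    by_contra hne
    have hlt : m < i + j := ((point_mem_Sap_iff ha hp hm).mp hS).lt_of_ne hne
    obtain _ | i := i
    · obtain ⟨j, rfl⟩ := Nat.exists_eq_add_one_of_ne_zero (show j ≠ 0 by omega)
      exact hE ![0, a ^ p] (by simp) ⟨_, point_mem_Sap (by omega), add_right m 0 j⟩
    · exact hE ![a, 0] (by simp) ⟨_, point_mem_Sap (by omega), add_left m i j⟩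
  · rintro rfl
    refine ⟨point_mem_Sap le_rfl, ?_⟩
    rintro e he ⟨s, hs, hse⟩
    obtain ⟨m', i', j', h', rfl⟩ := exists_point_eq_of_mem_Sap hs
    rcases he with rfl | rfl
    · rw [add_left] at hse
      have := excess_le_of_point_eq ha hp hm hse.symm
      omega
    · rw [add_right] at hse
      have := excess_le_of_point_eq ha hp hm hse.symm
      omega

theorem apery_Sap (ha : Odd a) (hp : 1 ≤ p) :
    apery (Sap a p) {![a, 0], ![0, a ^ p]} =
      {x | ∃ α α' : ℕ, α + α' < a ^ p ∧ x = α • ![a + 2, 2] + α' • ![2, 2 + a ^ p]} := by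
  ext x
  simp only [smul_add_smul_eq_point, Set.mem_ofPred_eq]
  constructor
  · intro hx
    obtain ⟨m, i, j, hm, rfl⟩ := exists_lt_pow_point_eq_of_mem_Sap ha.pos hp hx.1
    obtain rfl := (point_mem_apery_iff ha hp hm).mp hx
    exact ⟨i, j, hm, rfl⟩
  · rintro ⟨α, α', h, rfl⟩
    exact (point_mem_apery_iff ha hp h).mpr rfl

theorem cast_point_eq_of_lt {l : ℕ} (hl : l < a ^ p - 1) :
    ((point a p (a ^ p - 1) (a ^ p - 2 - l) l 0 : ℕ) : ℤ) =
        (a : ℤ) ^ p * (a + 2) - (l + 2) * a - 2 ∧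
      ((point a p (a ^ p - 1) (a ^ p - 2 - l) l 1 : ℕ) : ℤ) = (a : ℤ) ^ p * (l + 2) - 2 := by
  obtain ⟨r, hr⟩ := Nat.exists_eq_add_of_le (show l + 2 ≤ a ^ p by omega)
  have hr' : (a : ℤ) ^ p = l + 2 + r := by exact_mod_cast hr
  simp only [point, Matrix.cons_val_zero, Matrix.cons_val_one, Matrix.cons_val_fin_one,
    show a ^ p - 1 = l + 1 + r by omega, show a ^ p - 2 - l = r by omega]
  push_cast
  rw [hr']
  constructor <;> ring

theorem Delta_eq_image (ha : 0 < a) : Delta a p =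
    (fun l => point a p (a ^ p - 1) (a ^ p - 2 - l) l) '' Finset.range (a ^ p - 1) := by
  have lt_iff (l : ℕ) : (l : ℤ) < (a : ℤ) ^ p - 1 ↔ l < a ^ p - 1 := by
    rw [← Nat.cast_pow]
    have := pow_pos ha p
    omega
  ext x
  simp only [Set.mem_image, SetLike.mem_coe, Finset.mem_range]
  refine exists_congr fun l => (and_congr_left' (lt_iff l)).trans (and_congr_right fun hl => ?_)
  rw [← (cast_point_eq_of_lt hl).1, ← (cast_point_eq_of_lt hl).2, Nat.cast_inj, Nat.cast_inj,
    eq_comm (b := x), funext_iff, Fin.forall_fin_two]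

theorem encard_Delta (ha : 0 < a) : (Delta a p).encard = ((a ^ p - 1 : ℕ) : ℕ∞) := by
  rw [Delta_eq_image ha, Function.Injective.encard_image, Set.encard_coe_eq_coe_finsetCard,
    Finset.card_range]
  intro l l' h
  exact Nat.eq_of_mul_eq_mul_left (pow_pos ha p) (Nat.add_left_cancel (congrFun h 1))

theorem mem_cone_Sap (ha : 0 < a) (x : Fin 2 → ℕ) : (fun i => (x i : ℚ)) ∈ cone (Sap a p) := by
  have mem_cone {s : Fin 2 → ℕ} (hs : s ∈ Sap a p) : (fun i => (s i : ℚ)) ∈ cone (Sap a p) :=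
    Submodule.subset_span ⟨s, hs, rfl⟩
  have hleft := mem_cone (s := ![a, 0]) (AddSubmonoid.subset_closure (by simp))
  have hright := mem_cone (s := ![0, a ^ p]) (AddSubmonoid.subset_closure (by simp))
  have ha' : (a : ℚ) ≠ 0 := Nat.cast_ne_zero.mpr ha.ne'
  convert add_mem (Submodule.smul_mem _ ((x 0 : ℚ≥0) / a) hleft)
    (Submodule.smul_mem _ ((x 1 : ℚ≥0) / (a ^ p : ℕ)) hright) using 1
  ext i
  fin_cases i <;> simp [NNRat.smul_def, ha']

theorem point_mem_pseudoFrobenius (ha : Odd a) (hp : 1 ≤ p) (h : i + j + 2 = a ^ p) :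
    point a p (a ^ p - 1) i j ∈ pseudoFrobenius (Sap a p) := by
  refine ⟨⟨mem_cone_Sap ha.pos _, fun hmem => ?_⟩, fun s hs hs0 => ?_⟩
  · have := (point_mem_Sap_iff ha hp (by omega)).mp hmem
    omega
  · obtain ⟨m', i', j', h', rfl⟩ := exists_point_eq_of_mem_Sap hs
    rw [point_add]
    obtain _ | m' := m'
    · have hij : i' + j' ≠ 0 := by
        intro hij
        obtain ⟨rfl, rfl⟩ := Nat.add_eq_zero_iff.mp hij
        exact hs0 point_zero
      exact point_mem_Sap (by omega)
    · rw [show a ^ p - 1 + (m' + 1) = m' + a ^ p * 1 by omega, point_add_pow_mul hp]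
      exact point_mem_Sap (by omega)

theorem Delta_subset_pseudoFrobenius (ha : Odd a) (hp : 1 ≤ p) :
    Delta a p ⊆ pseudoFrobenius (Sap a p) := by
  rw [Delta_eq_image ha.pos]
  rintro _ ⟨l, hl, rfl⟩
  have := Finset.mem_range.mp hl
  exact point_mem_pseudoFrobenius ha hp (by omega)

theorem le_bettiType_Sap (ha : Odd a) (hp : 1 ≤ p) :
    ((a ^ p - 1 : ℕ) : ℕ∞) ≤ bettiType (Sap a p) :=
  encard_Delta ha.pos ▸ Set.encard_le_encard (Delta_subset_pseudoFrobenius ha hp)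

theorem point_mem_minimalGenerators (ha : Odd a) (hp : 1 ≤ p) (hm : m < a ^ p) (h : m ≤ i + j)
    (hij : i + j = 1) : point a p m i j ∈ minimalGenerators (Sap a p) := by
  refine ⟨point_mem_Sap h, fun h0 => ?_, fun y hy z hz hyz => ?_⟩
  · obtain ⟨c, -, hi, hj⟩ := exists_of_point_eq ha hp ha.pow.pos (point_zero.trans h0.symm)
    omega
  · obtain ⟨m₁, i₁, j₁, h₁, rfl⟩ := exists_point_eq_of_mem_Sap hy
    obtain ⟨m₂, i₂, j₂, h₂, rfl⟩ := exists_point_eq_of_mem_Sap hz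
    rw [point_add] at hyz
    obtain ⟨c, hm', hi, hj⟩ := exists_of_point_eq ha hp hm hyz.symm
    obtain rfl : c = 0 := by omega
    have eq_zero {m i j : ℕ} (h : m ≤ i + j) (hij : i + j = 0) : point a p m i j = 0 := by
      obtain ⟨rfl, rfl⟩ := Nat.add_eq_zero_iff.mp hij
      rw [Nat.le_zero.mp h, point_zero]
    rcases (show i₁ + j₁ = 0 ∨ i₂ + j₂ = 0 by omega) with h0 | h0
    · exact Or.inl (eq_zero h₁ h0)
    · exact Or.inr (eq_zero h₂ h0)

theorem minimalGenerators_Sap (ha : Odd a) (ha1 : 1 < a) (hp : 1 ≤ p) :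
    minimalGenerators (Sap a p) = {![a, 0], ![0, a ^ p], ![a + 2, 2], ![2, 2 + a ^ p]} := by
  have hq : 1 < a ^ p := Nat.one_lt_pow (by omega) ha1
  refine Set.Subset.antisymm (minimalGenerators_subset rfl) ?_
  rintro x (rfl | rfl | rfl | rfl)
  · rw [vec_left_eq_point (p := p)]
    exact point_mem_minimalGenerators ha hp (by omega) (by omega) rfl
  · rw [vec_right_eq_point]
    exact point_mem_minimalGenerators ha hp (by omega) (by omega) rfl
  · rw [vec_lower_eq_point (p := p)]
    exact point_mem_minimalGenerators ha hp hq le_rfl rfl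
  · rw [vec_upper_eq_point]
    exact point_mem_minimalGenerators ha hp hq le_rfl rfl

theorem embeddingDim_Sap (ha : Odd a) (ha1 : 1 < a) (hp : 1 ≤ p) : embeddingDim (Sap a p) = 4 := by
  rw [embeddingDim, minimalGenerators_Sap ha ha1 hp, Set.encard_insert_of_notMem,
    Set.encard_insert_of_notMem, Set.encard_pair]
  · norm_num
  · simp [ha.pos.ne']
  · simp [ha.pos.ne']
  · suffices (a = 0 → ¬0 = a ^ p) ∧ (a = 2 → ¬0 = 2 + a ^ p) by simpa
    omega

theorem isMPD_Sap (k : Type u) [Field k] (ha : Odd a) (ha1 : 1 < a) (hp : 1 ≤ p) :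
    IsMPD k (Sap a p) := by
  have hq : 1 < a ^ p := Nat.one_lt_pow (by omega) ha1
  refine isMPD_of_pseudoFrobenius_nonempty (minimalGenerators_Sap ha ha1 hp ▸ Set.toFinite _)
    ⟨_, point_mem_pseudoFrobenius ha hp (i := a ^ p - 2) (j := 0) (by omega)⟩

end AffineSemigroup

theorem mainTheorem4 (k : Type*) [Field k] :
    (∀ a p : ℕ, 3 ≤ a → Odd a → 1 ≤ p →
      AffineSemigroup.apery (AffineSemigroup.Sap a p) {![a, 0], ![0, a ^ p]} =
          {x | ∃ α α' : ℕ, α + α' < a ^ p ∧ x = α • ![a + 2, 2] + α' • ![2, 2 + a ^ p]} ∧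
        AffineSemigroup.IsMPD k (AffineSemigroup.Sap a p) ∧
        AffineSemigroup.Delta a p ⊆ AffineSemigroup.pseudoFrobenius (AffineSemigroup.Sap a p) ∧
        (AffineSemigroup.Delta a p).encard = ((a ^ p - 1 : ℕ) : ℕ∞) ∧
        ((a ^ p - 1 : ℕ) : ℕ∞) ≤ AffineSemigroup.bettiType (AffineSemigroup.Sap a p) ∧
        AffineSemigroup.embeddingDim (AffineSemigroup.Sap a p) = 4) ∧
    (∀ N : ℕ, ∃ a p : ℕ, 3 ≤ a ∧ Odd a ∧ 1 ≤ p ∧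
      AffineSemigroup.IsMPD k (AffineSemigroup.Sap a p) ∧
      AffineSemigroup.embeddingDim (AffineSemigroup.Sap a p) = 4 ∧
      (N : ℕ∞) ≤ AffineSemigroup.bettiType (AffineSemigroup.Sap a p)) := by
  open AffineSemigroup in
  have h3 : Odd 3 := by decide
  refine ⟨fun a p ha3 ha hp => ⟨apery_Sap ha hp, isMPD_Sap k ha (by omega) hp,
    Delta_subset_pseudoFrobenius ha hp, encard_Delta ha.pos, le_bettiType_Sap ha hp,
    embeddingDim_Sap ha (by omega) hp⟩, fun N => ⟨3, N + 1, le_rfl, h3, by omega,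
    isMPD_Sap k h3 (by omega) (by omega), embeddingDim_Sap h3 (by omega) (by omega), ?_⟩⟩
  have hN : N + 1 < 3 ^ (N + 1) := Nat.lt_pow_self (by omega)
  exact le_trans (Nat.cast_le.mpr (by omega)) (le_bettiType_Sap h3 (by omega))
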